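/- For a finite additive abelian group $G$ and a positive integer $k$, let $g^k(G)$ denote the smallest positive integer $\ell$ such that every subset $S\subseteq G$ with $|S|\ge \ell$ contains a subset $T\subseteq S$ with $|T|=k$ and $\sum_{x\in T}x=0$ (for $\ell>|G|$ the condition holds vacuously). Let $C_p$ be the cyclic group of prime order $p$. Let $p$ be a prime, let $k$ be an integer, and suppose that either $k=2m$ with $m\ge 2$ and $p>m^2$, or $k=2m+1$ with $m\ge 1$, $p>\frac{2m^3+5m^2-8m-3}{2(m+1)}$ and $p>k$. Let $p\equiv r\pmod k$. (i) If $k=2m$ is even and $r\in\{1,m+1,m+2,\dots,k-1\}$, then $$g^k(C_p)=\begin{cases}\frac{p-1}{k}+k,&\text{if } r=1,\\[2pt] \frac{p-r}{k}+k+1,&\text{if } r\ne 1.\end{cases}$$ (ii) If $k=2m+1$ is odd and $r\in\{1,\dots,k-1\}$, then $$\begin{cases} g^k(C_p)=\frac{p-1}{k}+k,&\text{if } r=1,\\[2pt] \frac{p-r}{k}+k\le g^k(C_p)\le \frac{p-r}{k}+k+1,&\text{if } r\ne 1.\end{cases}$$ -/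

import Mathlib

/-- `HarborthProperty G k l`: every set `S` of at least `l` elements of `G` contains a subset `T`
with exactly `k` (distinct) elements whose sum is zero. -/
def HarborthProperty (G : Type*) [AddCommGroup G] (k l : ℕ) : Prop :=
  ∀ S : Finset G, l ≤ S.card → ∃ T : Finset G, T ⊆ S ∧ T.card = k ∧ ∑ x ∈ T, x = 0

/-- The `k`-Harborth constant of `G`: the smallest positive integer `l` such that every subset of
`G` with at least `l` elements contains a zero-sum subset of size `k`. -/
noncomputable def kHarborth (G : Type*) [AddCommGroup G] (k : ℕ) : ℕ :=
  sInf {l : ℕ | 0 < l ∧ HarborthProperty G k l}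

/-- For a finite group the minimum exists, so that `kHarborth` is never a junk value. -/
theorem kHarborth_isLeast (G : Type*) [AddCommGroup G] [Fintype G] (k : ℕ) :
    IsLeast {l : ℕ | 0 < l ∧ HarborthProperty G k l} (kHarborth G k) := by
  have hne : {l : ℕ | 0 < l ∧ HarborthProperty G k l}.Nonempty :=
    ⟨Fintype.card G + 1, Nat.succ_pos _, fun S hS => by
      have := S.card_le_univ
      omega⟩
  exact ⟨Nat.sInf_mem hne, fun _ hl => Nat.sInf_le hl⟩

/-!
Both bounds concern the restricted sumset of `S`, the set of sums of `k` distinct elements of `S`.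

By the Dias da Silva–Hamidoune theorem, it has at least `min p (k (|S| - k) + 1)` elements in
`ℤ/pℤ`. The proof is by the polynomial method: if a polynomial `Q` of degree `N ≤ k (|S| - k)`
vanished on all these sums, then `Q(x₁ + ⋯ + xₖ) · ∏_{i < j} (xⱼ - xᵢ)` would vanish on `Sᵏ`. Up to
a nonzero factor, its coefficient at `x ^ c`, where the `cᵢ < |S|` are distinct and `∑ cᵢ` is the
total degree, is `N! ∏_{i < j} (cⱼ - cᵢ) / ∏ cᵢ!`, which is nonzero modulo `p` for `N < p`, and this
contradicts the combinatorial Nullstellensatz.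

Conversely, the sums of `k` distinct elements of an interval of length `k + d` lie in an interval of
length `k d + 1`; if `k d + 1 < p`, a translation moves the latter to `{1, …, k d + 1}`, so that it
misses `0`.
-/

open MvPolynomial Finset
open scoped Nat

section RestrictedSumset

variable {G H : Type*} [AddCommMonoid G] [AddCommMonoid H] [DecidableEq G] [DecidableEq H]

/-- The restricted sumset `k^S` of additive combinatorics: all sums of `k` distinct elements
of `S`. -/
def restrictedSumset (k : ℕ) (S : Finset G) : Finset G :=
  (S.powersetCard k).image fun T => ∑ x ∈ T, x

lemma mem_restrictedSumset {k : ℕ} {S : Finset G} {y : G} :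
    y ∈ restrictedSumset k S ↔ ∃ T ⊆ S, #T = k ∧ ∑ x ∈ T, x = y := by
  simp only [restrictedSumset, mem_image, mem_powersetCard, and_assoc]

lemma restrictedSumset_image_subset (f : G →+ H) (k : ℕ) (S : Finset G) :
    restrictedSumset k (S.image f) ⊆ (restrictedSumset k S).image f := by
  intro y hy
  obtain ⟨T, hTS, rfl, rfl⟩ := mem_restrictedSumset.1 hy
  obtain ⟨U, hUS, hUT, hU⟩ := exists_subset_injOn_image_eq_of_surjOn (f := f) S T <| by
    simpa only [Set.SurjOn, ← coe_image, coe_subset] using hTS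
  refine mem_image.2 ⟨∑ x ∈ U, x, mem_restrictedSumset.2 ⟨U, hUS, ?_, rfl⟩, ?_⟩
  · rw [← hU, card_image_of_injOn hUT]
  · rw [map_sum, ← hU, sum_image hUT]

lemma restrictedSumset_Ico_subset (k : ℕ) (a b : ℤ) :
    restrictedSumset k (Ico a b) ⊆ Icc (∑ i ∈ range k, (a + i)) (∑ i ∈ range k, (b - 1 - i)) := by
  intro y hy
  obtain ⟨T, hT, rfl, rfl⟩ := mem_restrictedSumset.1 hy
  exact mem_Icc.2 ⟨sum_range_le_sum fun x hx => (mem_Ico.1 (hT hx)).1,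
    sum_le_sum_range fun x hx => Int.le_sub_one_of_lt (mem_Ico.1 (hT hx)).2⟩

end RestrictedSumset

section Exponents

/-- A case of Hermite's identity. -/
lemma sum_range_add_div (N : ℕ) {k : ℕ} (hk : 0 < k) : ∑ i ∈ range k, (N + i) / k = N := by
  induction N with
  | zero => exact sum_eq_zero fun i hi => by rw [zero_add, Nat.div_eq_of_lt (mem_range.1 hi)]
  | succ N ih =>
    have h := sum_range_succ' (fun i => (N + i) / k) k
    rw [sum_range_succ, ih, Nat.add_div_right N hk, add_zero] at h
    simp only [add_right_comm N 1, add_assoc] at h ⊢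
    omega

lemma exists_strictMono_sum_eq {k n N : ℕ} (hkn : k ≤ n) (hN : N ≤ k * (n - k)) :
    ∃ c : Fin k → ℕ, StrictMono c ∧ (∀ i, c i < n) ∧ ∑ i, c i = N + ∑ i : Fin k, (i : ℕ) := by
  rcases Nat.eq_zero_or_pos k with rfl | hk
  · exact ⟨Fin.elim0, fun i => i.elim0, fun i => i.elim0, by simp_all⟩
  refine ⟨fun i => (N + i) / k + i, fun i j hij => ?_, fun i => ?_, ?_⟩
  · exact add_lt_add_of_le_of_lt (Nat.div_le_div_right (by gcongr; exact hij.le)) hij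
  · have hi := i.2
    have hdiv : (N + i) / k < n - k + 1 := by
      rw [Nat.div_lt_iff_lt_mul hk, add_mul, mul_comm (n - k)]
      omega
    change (N + i) / k + i < n
    omega
  · rw [sum_add_distrib, Fin.sum_univ_eq_sum_range (fun i => (N + i) / k), sum_range_add_div N hk]

end Exponents

section Homogeneous

variable {R σ : Type*} [CommRing R]

lemma isHomogeneous_det {ι : Type*} [Fintype ι] [DecidableEq ι]
    {M : Matrix ι ι (MvPolynomial σ R)} {d : ι → ℕ} (hM : ∀ i j, (M i j).IsHomogeneous (d j)) :
    M.det.IsHomogeneous (∑ j, d j) := by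
  rw [Matrix.det_apply]
  refine IsHomogeneous.sum _ _ _ fun τ _ => ?_
  exact Submodule.smul_of_tower_mem (homogeneousSubmodule σ R _) _
    (IsHomogeneous.prod _ _ _ fun i _ => hM (τ i) i)

lemma totalDegree_aeval_le (s : MvPolynomial σ R) (Q : Polynomial R) :
    (Polynomial.aeval s Q).totalDegree ≤ Q.natDegree * s.totalDegree := by
  rw [Polynomial.aeval_eq_sum_range]
  refine totalDegree_finsetSum_le fun j hj => ?_
  calc (Q.coeff j • s ^ j).totalDegree
      ≤ j * s.totalDegree := (totalDegree_smul_le _ _).trans (totalDegree_pow s j)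
    _ ≤ Q.natDegree * s.totalDegree := by
      gcongr
      exact Nat.lt_succ_iff.1 (mem_range.1 hj)

lemma coeff_aeval_mul_of_isHomogeneous {s V : MvPolynomial σ R} {d N : ℕ} {c : σ →₀ ℕ}
    (hs : s.IsHomogeneous 1) (hV : V.IsHomogeneous d) (Q : Polynomial R) (hc : c.degree = N + d) :
    coeff c (Polynomial.aeval s Q * V) = Q.coeff N * coeff c (s ^ N * V) := by
  have hcoeff : ∀ j ≠ N, coeff c (s ^ j * V) = 0 := fun j hj =>
    ((hs.pow j).mul hV).coeff_eq_zero (by omega)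
  rw [Polynomial.aeval_eq_sum_range, sum_mul, coeff_sum]
  simp only [smul_mul_assoc, coeff_smul, smul_eq_mul]
  refine sum_eq_single N (fun j _ hj => by rw [hcoeff j hj, mul_zero]) fun hN => ?_
  rw [Polynomial.coeff_eq_zero_of_natDegree_lt (by simpa using hN), zero_mul]

end Homogeneous

section Vandermonde

lemma isHomogeneous_det_vandermonde_X (R : Type*) [CommRing R] (k : ℕ) :
    (Matrix.vandermonde (X : Fin k → MvPolynomial (Fin k) R)).det.IsHomogeneous
      (∑ i : Fin k, (i : ℕ)) :=
  isHomogeneous_det fun i j => isHomogeneous_X_pow i j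

lemma eval_det_vandermonde_X {R : Type*} [CommRing R] {k : ℕ} (x : Fin k → R) :
    eval x (Matrix.vandermonde X).det = (Matrix.vandermonde x).det := by
  rw [RingHom.map_det]
  congr 1
  ext i j
  simp [Matrix.vandermonde_apply]

lemma det_vandermonde_X_eq_sum (R : Type*) [CommRing R] (k : ℕ) :
    (Matrix.vandermonde (X : Fin k → MvPolynomial (Fin k) R)).det =
      ∑ σ : Equiv.Perm (Fin k), (Equiv.Perm.sign σ : ℤ) •
        monomial (Finsupp.equivFunOnFinite.symm fun i => (σ i : ℕ)) (1 : R) := by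
  rw [← Matrix.det_transpose, Matrix.det_apply]
  refine sum_congr rfl fun σ _ => ?_
  rw [Units.smul_def, monomial_eq, Finsupp.prod_fintype _ _ (by simp)]
  simp [Matrix.vandermonde_apply]

/- With the denominators `cᵢ!` of the multinomial coefficient cleared, the right-hand side is a term
of the Leibniz expansion of a determinant of descending factorials, which column operations turn
into a Vandermonde determinant. -/
lemma prod_factorial_mul_coeff_sum_X_pow_mul_monomial {R ι : Type*} [CommRing R] [Fintype ι]
    {c e : ι →₀ ℕ} {N : ℕ} (h : ∑ i, c i = N + ∑ i, e i) :
    (∏ i, ((c i)! : R)) * coeff c ((∑ i, X i : MvPolynomial ι R) ^ N * monomial e 1) =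
      N ! * ∏ i, ((c i).descFactorial (e i) : R) := by
  classical
  rw [coeff_mul_monomial', mul_one]
  split_ifs with hle
  · have hsum : ∑ i, (c - e) i = N := by
      have : ∑ i, c i = ∑ i, (c - e) i + ∑ i, e i := by
        rw [← sum_add_distrib]
        exact sum_congr rfl fun i _ => (Nat.sub_add_cancel (hle i)).symm
      omega
    have hmultinomial := Nat.multinomial_spec univ (c - e : ι →₀ ℕ)
    rw [hsum] at hmultinomial
    rw [coeff_sum_X_pow_of_fintype, if_pos (by rwa [Finsupp.sum_fintype _ _ (by simp)]),
      Finsupp.multinomial_eq_of_support_subset (subset_univ _)]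
    norm_cast
    rw [← hmultinomial, mul_right_comm, ← prod_mul_distrib]
    congr 2
    exact prod_congr rfl fun i _ => (Nat.factorial_mul_descFactorial (hle i)).symm
  · obtain ⟨i, hi⟩ : ∃ i, c i < e i := by
      by_contra! hcon
      exact hle hcon
    rw [mul_zero, prod_eq_zero (mem_univ i), mul_zero]
    rw [Nat.descFactorial_of_lt hi, Nat.cast_zero]

lemma prod_factorial_mul_coeff_sum_X_pow_mul_det_vandermonde {R : Type*} [CommRing R] [IsDomain R]
    {k N : ℕ} {c : Fin k →₀ ℕ} (h : ∑ i, c i = N + ∑ i : Fin k, (i : ℕ)) :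
    (∏ i, ((c i)! : R)) *
        coeff c ((∑ i, X i : MvPolynomial (Fin k) R) ^ N * (Matrix.vandermonde X).det) =
      N ! * (Matrix.vandermonde fun i => (c i : R)).det := by
  rw [Matrix.det_eval_matrixOfPolynomials_eq_det_vandermonde (fun i => (c i : R))
    (fun i => descPochhammer R i) (fun i => descPochhammer_natDegree R i)
    (fun i => monic_descPochhammer R i), det_vandermonde_X_eq_sum, ← Matrix.det_transpose,
    Matrix.det_apply, mul_sum, coeff_sum, mul_sum, mul_sum]
  refine sum_congr rfl fun σ _ => ?_
  have hσ : ∑ i, c i = N + ∑ i, (σ i : ℕ) := by rw [h, Equiv.sum_comp σ fun i => (i : ℕ)]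
  rw [mul_smul_comm, coeff_smul, mul_smul_comm, Units.smul_def, mul_smul_comm,
    prod_factorial_mul_coeff_sum_X_pow_mul_monomial hσ]
  simp [descPochhammer_eval_eq_descFactorial]

end Vandermonde

section DiasDaSilvaHamidoune

lemma exists_injective_eval_sum_ne_zero {R : Type*} [CommRing R] [IsDomain R] {k : ℕ}
    {S : Finset R} {Q : Polynomial R} (hQ : Q ≠ 0) (hkS : k ≤ #S)
    (hdeg : Q.natDegree ≤ k * (#S - k)) (hfact : (Q.natDegree ! : R) ≠ 0)
    (hcast : Set.InjOn (Nat.cast : ℕ → R) (Set.Iio #S)) :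
    ∃ x : Fin k → R, Function.Injective x ∧ (∀ i, x i ∈ S) ∧ Q.eval (∑ i, x i) ≠ 0 := by
  obtain ⟨c, hc, hcS, hcsum⟩ := exists_strictMono_sum_eq hkS hdeg
  set t : Fin k →₀ ℕ := Finsupp.equivFunOnFinite.symm c with ht
  set s : MvPolynomial (Fin k) R := ∑ i, X i with hs
  set V : MvPolynomial (Fin k) R := (Matrix.vandermonde X).det
  have hshom : s.IsHomogeneous 1 := IsHomogeneous.sum _ _ _ fun i _ => isHomogeneous_X _ i
  have hVhom : V.IsHomogeneous (∑ i : Fin k, (i : ℕ)) := isHomogeneous_det_vandermonde_X R k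
  have htdeg : t.degree = Q.natDegree + ∑ i : Fin k, (i : ℕ) := by
    rw [Finsupp.degree_eq_sum, ← hcsum, ht, Finsupp.coe_equivFunOnFinite_symm]
  have hvand : (Matrix.vandermonde fun i => (t i : R)).det ≠ 0 :=
    Matrix.det_vandermonde_ne_zero_iff.2 fun i j hij =>
      hc.injective (hcast (hcS i) (hcS j) hij)
  have hcoeff : coeff t (Polynomial.aeval s Q * V) ≠ 0 := by
    rw [coeff_aeval_mul_of_isHomogeneous hshom hVhom Q htdeg]
    refine mul_ne_zero (Polynomial.leadingCoeff_ne_zero.2 hQ) (right_ne_zero_of_mul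
      (a := ∏ i, ((t i)! : R)) ?_)
    rw [prod_factorial_mul_coeff_sum_X_pow_mul_det_vandermonde hcsum]
    exact mul_ne_zero hfact hvand
  have htot : (Polynomial.aeval s Q * V).totalDegree = t.degree := by
    refine le_antisymm ?_ (le_totalDegree (mem_support_iff.2 hcoeff))
    calc (Polynomial.aeval s Q * V).totalDegree
        ≤ Q.natDegree * s.totalDegree + V.totalDegree :=
          (totalDegree_mul _ _).trans (Nat.add_le_add_right (totalDegree_aeval_le s Q) _)
      _ ≤ Q.natDegree * 1 + ∑ i : Fin k, (i : ℕ) := by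
          gcongr
          exacts [hshom.totalDegree_le, hVhom.totalDegree_le]
      _ = t.degree := by rw [mul_one, htdeg]
  obtain ⟨x, hxS, hx⟩ := combinatorial_nullstellensatz_exists_eval_nonzero _ t hcoeff htot
    (fun _ => S) hcS
  have hxQ : eval x (Polynomial.aeval s Q) = Q.eval (∑ i, x i) := by
    rw [← coe_aeval_eq_eval, RingHom.coe_coe, ← Polynomial.aeval_algHom_apply, hs, map_sum]
    simp
  rw [map_mul, hxQ, eval_det_vandermonde_X, mul_ne_zero_iff,
    Matrix.det_vandermonde_ne_zero_iff] at hx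
  exact ⟨x, hx.2, hxS, hx.1⟩

lemma exists_mem_restrictedSumset_eval_ne_zero {R : Type*} [CommRing R] [IsDomain R]
    [DecidableEq R] {k : ℕ} {S : Finset R} {Q : Polynomial R} (hQ : Q ≠ 0) (hkS : k ≤ #S)
    (hdeg : Q.natDegree ≤ k * (#S - k)) (hfact : (Q.natDegree ! : R) ≠ 0)
    (hcast : Set.InjOn (Nat.cast : ℕ → R) (Set.Iio #S)) :
    ∃ y ∈ restrictedSumset k S, Q.eval y ≠ 0 := by
  obtain ⟨x, hx, hxS, hxQ⟩ := exists_injective_eval_sum_ne_zero hQ hkS hdeg hfact hcast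
  refine ⟨∑ i, x i, mem_restrictedSumset.2 ⟨univ.image x, ?_, ?_, ?_⟩, hxQ⟩
  · exact image_subset_iff.2 fun i _ => hxS i
  · rw [card_image_of_injective _ hx, card_univ, Fintype.card_fin]
  · exact sum_image hx.injOn

lemma natCast_zmod_injOn (p : ℕ) : Set.InjOn (Nat.cast : ℕ → ZMod p) (Set.Iio p) :=
  fun a ha b hb hab => by
    rwa [ZMod.natCast_eq_natCast_iff', Nat.mod_eq_of_lt ha, Nat.mod_eq_of_lt hb] at hab

/-- The Dias da Silva–Hamidoune theorem; `k = 2` is the Erdős–Heilbronn conjecture. -/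
theorem le_card_restrictedSumset {p k : ℕ} [Fact p.Prime] {S : Finset (ZMod p)} (hkS : k ≤ #S) :
    min p (k * (#S - k) + 1) ≤ #(restrictedSumset k S) := by
  by_contra! hlt
  obtain ⟨hltp, hltk⟩ := lt_min_iff.1 hlt
  let Q : Polynomial (ZMod p) := ∏ a ∈ restrictedSumset k S, (Polynomial.X - Polynomial.C a)
  have hQdeg : Q.natDegree = #(restrictedSumset k S) :=
    Polynomial.natDegree_finsetProd_X_sub_C_eq_card _ id
  have hfact : (Q.natDegree ! : ZMod p) ≠ 0 := by
    rw [Ne, ZMod.natCast_eq_zero_iff, (Fact.out : p.Prime).dvd_factorial, hQdeg]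
    omega
  have hSp : #S ≤ p := by simpa only [ZMod.card] using S.card_le_univ
  obtain ⟨y, hy, hQy⟩ := exists_mem_restrictedSumset_eval_ne_zero (Q := Q)
    (Polynomial.monic_prod_X_sub_C _ _).ne_zero hkS (by omega) hfact
    ((natCast_zmod_injOn p).mono (Set.Iio_subset_Iio hSp))
  refine hQy ?_
  rw [Polynomial.eval_prod]
  exact prod_eq_zero hy (by simp)

end DiasDaSilvaHamidoune

section Harborth

lemma HarborthProperty.mono {G : Type*} [AddCommGroup G] {k l l' : ℕ} (h : HarborthProperty G k l)
    (hl : l ≤ l') : HarborthProperty G k l' :=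
  fun S hS => h S (hl.trans hS)

variable {p k : ℕ} [Fact p.Prime]

lemma harborthProperty_zmod_of_le {d : ℕ} (h : p ≤ k * d + 1) :
    HarborthProperty (ZMod p) k (k + d) := by
  intro S hS
  have hd : k * d ≤ k * (#S - k) := Nat.mul_le_mul_left k (by omega)
  have hcard : p ≤ #(restrictedSumset k S) :=
    (le_min le_rfl (by omega)).trans (le_card_restrictedSumset (by omega))
  have huniv : restrictedSumset k S = univ :=
    (card_eq_iff_eq_univ _).1 (le_antisymm (card_le_univ _) (by rwa [ZMod.card]))
  exact mem_restrictedSumset.1 (huniv ▸ mem_univ 0)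

lemma sum_range_sub_one_sub (k : ℕ) (a d : ℤ) :
    ∑ i ∈ range k, (a + k + d - 1 - i) = ∑ i ∈ range k, (a + i) + k * d := by
  have hreflect := sum_range_reflect (fun i : ℕ => a + d + (i : ℤ)) k
  calc ∑ i ∈ range k, (a + k + d - 1 - i)
      = ∑ i ∈ range k, (a + d + ((k - 1 - i : ℕ) : ℤ)) := sum_congr rfl fun i hi => by
        have := mem_range.1 hi
        omega
    _ = ∑ i ∈ range k, (a + i) + k * d := by
        rw [hreflect]
        simp only [sum_add_distrib, sum_const, card_range, nsmul_eq_mul]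
        ring

lemma exists_sum_range_add_eq_one (hk : 0 < k) (hkp : k < p) :
    ∃ a : ℤ, ((∑ i ∈ range k, (a + i) : ℤ) : ZMod p) = 1 := by
  have hk0 : (k : ZMod p) ≠ 0 := by
    rw [Ne, ZMod.natCast_eq_zero_iff]
    exact Nat.not_dvd_of_pos_of_lt hk hkp
  obtain ⟨a, ha⟩ := ZMod.intCast_surjective ((k : ZMod p)⁻¹ * (1 - ∑ i ∈ range k, (i : ZMod p)))
  refine ⟨a, ?_⟩
  push_cast
  rw [sum_add_distrib, sum_const, card_range, nsmul_eq_mul, ha, mul_inv_cancel_left₀ hk0,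
    sub_add_cancel]

lemma le_of_harborthProperty_zmod {d : ℕ} (hk : 0 < k) (hkp : k < p)
    (h : HarborthProperty (ZMod p) k (k + d)) : p ≤ k * d + 1 := by
  by_contra! hlt
  have hkdp : k + d ≤ p := by nlinarith [Nat.zero_le d]
  obtain ⟨a, ha⟩ := exists_sum_range_add_eq_one hk hkp
  have hinj : Set.InjOn (Int.castAddHom (ZMod p)) (Ico a (a + k + d)) := fun x hx y hy hxy => by
    rw [coe_Ico, Set.mem_Ico] at hx hy
    have hdvd := (ZMod.intCast_eq_intCast_iff_dvd_sub x y p).1 hxy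
    have := Int.eq_zero_of_abs_lt_dvd hdvd (abs_lt.2 ⟨by omega, by omega⟩)
    omega
  have hzero : (0 : ZMod p) ∈
      restrictedSumset k ((Ico a (a + k + d)).image (Int.castAddHom (ZMod p))) := by
    refine mem_restrictedSumset.2 (h _ ?_)
    rw [card_image_of_injOn hinj, Int.card_Ico]
    omega
  obtain ⟨z, hz, hz0⟩ := mem_image.1 (restrictedSumset_image_subset _ _ _ hzero)
  obtain ⟨hlow, hupp⟩ := mem_Icc.1 (restrictedSumset_Ico_subset _ _ _ hz)
  rw [sum_range_sub_one_sub] at hupp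
  have hdvd : (p : ℤ) ∣ z - ∑ i ∈ range k, (a + i) + 1 := by
    rw [← ZMod.intCast_zmod_eq_zero_iff_dvd, Int.cast_add, Int.cast_sub, ha]
    simpa using hz0
  have hle := Int.le_of_dvd (by linarith) hdvd
  zify at hlt
  linarith

theorem kHarborth_zmod (hk : 0 < k) (hkp : k < p) :
    kHarborth (ZMod p) k = k + (p - 1) ⌈/⌉ k := by
  refine (kHarborth_isLeast (ZMod p) k).unique ⟨⟨by omega, harborthProperty_zmod_of_le ?_⟩, ?_⟩
  · exact Nat.sub_le_iff_le_add.1 (le_smul_ceilDiv hk)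
  · rintro l ⟨-, hl⟩
    have hprop : HarborthProperty (ZMod p) k (k + (l - k)) := hl.mono (by omega)
    have hlow : (p - 1) ⌈/⌉ k ≤ l - k := (ceilDiv_le_iff_le_mul hk).2
      (Nat.sub_le_iff_le_add.2 (le_of_harborthProperty_zmod hk hkp hprop))
    have hpos : ¬ (p - 1) ⌈/⌉ k ≤ 0 := by
      rw [ceilDiv_le_iff_le_mul hk]
      omega
    omega

end Harborth

lemma ceilDiv_mul_add (q : ℕ) {k s : ℕ} (hs : 0 < s) (hsk : s ≤ k) :
    (k * q + s) ⌈/⌉ k = q + 1 := by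
  rw [Nat.ceilDiv_eq_add_pred_div, show k * q + s + k - 1 = s - 1 + k * (q + 1) by
    rw [mul_add]; omega, Nat.add_mul_div_left _ _ (by omega), Nat.div_eq_of_lt (by omega), zero_add]

theorem theorem3p11_general (p k r : ℕ) (hp : p.Prime) (hr : p ≡ r [MOD k]) (hr1 : 1 ≤ r)
    (hrk : r < k) (hkp : k < p) :
    (r = 1 → (kHarborth (ZMod p) k : ℚ) = ((p : ℚ) - 1) / k + k) ∧
      (r ≠ 1 → (kHarborth (ZMod p) k : ℚ) = ((p : ℚ) - r) / k + k + 1) := by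
  have : Fact p.Prime := ⟨hp⟩
  have hk : 0 < k := by omega
  obtain ⟨q, rfl⟩ : ∃ q, p = k * q + r := ⟨p / k, by
    rw [← Nat.mod_eq_of_lt hrk, ← hr, Nat.div_add_mod]⟩
  have hdiv : (((k * q + r : ℕ) : ℚ) - r) / k = q := by
    have : (k : ℚ) ≠ 0 := by positivity
    push_cast
    field_simp
    ring
  rw [kHarborth_zmod hk hkp]
  refine ⟨?_, fun hr_ne => ?_⟩
  · rintro rfl
    have hceil : (k * q + 1 - 1) ⌈/⌉ k = q := smul_ceilDiv hk q
    rw [hceil, ← Nat.cast_one (R := ℚ), hdiv, Nat.cast_add, add_comm]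
  · rw [Nat.add_sub_assoc hr1, ceilDiv_mul_add q (by omega) (by omega), hdiv]
    push_cast
    ring

theorem theorem3p11 (p k m r : ℕ) (hp : p.Prime) (hr : p ≡ r [MOD k]) :
    (k = 2 * m → 2 ≤ m → m ^ 2 < p → (r = 1 ∨ (m + 1 ≤ r ∧ r < k)) →
      (r = 1 → (kHarborth (ZMod p) k : ℚ) = ((p : ℚ) - 1) / k + k) ∧
      (r ≠ 1 → (kHarborth (ZMod p) k : ℚ) = ((p : ℚ) - r) / k + k + 1)) ∧
    (k = 2 * m + 1 → 1 ≤ m →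
      (2 * (m : ℚ) ^ 3 + 5 * (m : ℚ) ^ 2 - 8 * m - 3) / (2 * ((m : ℚ) + 1)) < p →
      k < p → (1 ≤ r ∧ r < k) →
      (r = 1 → (kHarborth (ZMod p) k : ℚ) = ((p : ℚ) - 1) / k + k) ∧
      (r ≠ 1 → ((p : ℚ) - r) / k + k ≤ (kHarborth (ZMod p) k : ℚ) ∧
        (kHarborth (ZMod p) k : ℚ) ≤ ((p : ℚ) - r) / k + k + 1)) := by
  refine ⟨fun _ _ hmp hrm => ?_, fun _ _ _ hkp hrm => ?_⟩
  · exact theorem3p11_general p k r hp hr (by omega) (by omega) (by nlinarith)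
  · exact (theorem3p11_general p k r hp hr hrm.1 hrm.2 hkp).imp_right
      fun h hr1 => ⟨by linarith [h hr1], (h hr1).le⟩
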